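/- Let $\mathbb K$ be an algebraically closed field of arbitrary characteristic, let $V$ be a finite-dimensional vector space over $\mathbb K$ with $\dim V\ge 2$, and let $\mathfrak g=\mathfrak{gl}(V)$. Let $e\in\mathfrak g$ be any nilpotent element and let $\mathfrak g_e=\{x\in\mathfrak g \mid [x,e]=0\}$ be its centraliser. For $\gamma\in\mathfrak g_e^*$ put $\mathfrak g_e^\gamma=\{x\in\mathfrak g_e\mid \gamma([x,y])=0 \text{ for all } y\in\mathfrak g_e\}$, let $\operatorname{ind}\mathfrak g_e=\min_{\gamma\in\mathfrak g_e^*}\dim\mathfrak g_e^\gamma$, and let $$(\mathfrak g_e^*)_{\rm sing}=\{\gamma\in\mathfrak g_e^*\mid \dim\mathfrak g_e^\gamma>\operatorname{ind}\mathfrak g_e\}.$$ Then $(\mathfrak g_e^*)_{\rm sing}$ has codimension $\ge 2$ in the affine space $\mathfrak g_e^*$ (the empty set having codimension $\infty$); that is, the ideal of all polynomial functions on $\mathfrak g_e^*$ vanishing on $(\mathfrak g_e^*)_{\rm sing}$ has height $\ge 2$ in the algebra of polynomial functions on $\mathfrak g_e^*$ (the unit ideal having height $\infty$). -/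

import Mathlib

/-- The centraliser `g_e = {x ∈ g | [x, e] = 0}` of an element `e` of a Lie algebra `g`,
as a Lie subalgebra of `g`. -/
def elementCentraliser (K : Type*) {L : Type*} [CommRing K] [LieRing L] [LieAlgebra K L] (e : L) :
    LieSubalgebra K L where
  carrier := {x | ⁅x, e⁆ = 0}
  add_mem' := by
    intro a b ha hb
    simp only [Set.mem_ofPred_eq] at ha hb ⊢
    rw [add_lie, ha, hb, add_zero]
  zero_mem' := by simp
  smul_mem' := by
    intro c x hx
    simp only [Set.mem_ofPred_eq] at hx ⊢
    rw [smul_lie, hx, smul_zero]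
  lie_mem' := by
    intro a b ha hb
    have ha' : ⁅a, e⁆ = 0 := ha
    have hb' : ⁅b, e⁆ = 0 := hb
    change ⁅⁅a, b⁆, e⁆ = 0
    rw [lie_lie, ha', hb', lie_zero, lie_zero, sub_zero]

section LieFunctionals

variable (K : Type*) {Q : Type*} [Field K] [LieRing Q] [LieAlgebra K Q]

/-- The stabiliser `q^γ` of a linear function `γ` on a Lie algebra `q` for the coadjoint action,
i.e. the set of `x ∈ q` with `γ([x, y]) = 0` for all `y ∈ q`. -/
def coadjointStabiliser (γ : Module.Dual K Q) : Submodule K Q where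
  carrier := {x | ∀ y : Q, γ ⁅x, y⁆ = 0}
  add_mem' := by
    intro a b ha hb y
    rw [add_lie, map_add, ha y, hb y, add_zero]
  zero_mem' := by
    intro y
    rw [zero_lie, map_zero]
  smul_mem' := by
    intro c x hx y
    rw [smul_lie, map_smul, hx y, smul_zero]

variable (Q) in
/-- The index `ind q = min_γ dim q^γ` of a finite-dimensional Lie algebra `q`
(the infimum of a nonempty set of natural numbers, hence a minimum). -/
noncomputable def lieIndex : ℕ :=
  ⨅ γ : Module.Dual K Q, Module.finrank K (coadjointStabiliser K γ)

variable (Q) in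
/-- The singular locus `q^*_sing` : all linear functions `γ` on `q` with `dim q^γ > ind q`. -/
def singularLocus : Set (Module.Dual K Q) :=
  {γ | lieIndex K Q < Module.finrank K (coadjointStabiliser K γ)}

end LieFunctionals

section Codimension

variable {K : Type*} {M : Type*} [Field K] [AddCommGroup M] [Module K M]

/-- The ideal of all polynomial functions on the dual space `M^*` that vanish on the subset `Z`.
The algebra of polynomial functions on `M^*` is the symmetric algebra `S(M)`; the value of
`f ∈ S(M)` at `γ ∈ M^*` is the image of `f` under the algebra map `S(M) → K` extending `γ`. -/
noncomputable def dualVanishingIdeal (Z : Set (Module.Dual K M)) : Ideal (SymmetricAlgebra K M) :=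
  ⨅ γ ∈ Z, RingHom.ker (SymmetricAlgebra.lift γ : SymmetricAlgebra K M →ₐ[K] K)

/-- The codimension in the affine space `M^*` of the Zariski closure of `Z ⊆ M^*`, i.e. the
height of the vanishing ideal of `Z` in the coordinate ring `S(M)` of `M^*`
(the empty set has codimension `⊤`). -/
noncomputable def dualCodim (Z : Set (Module.Dual K M)) : ℕ∞ :=
  (dualVanishingIdeal Z).height

end Codimension

-- `gl(V)` is `Module.End K V` with the commutator bracket
attribute [local instance 100] LieRing.ofAssociativeRing

/-! The idea is to find a plane in $\mathfrak g_e^*$ meeting the singular locus at most in the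
origin. Outside the locus a point is separated from it by a Gram determinant of the form
$([u_j,u_i])$, whose entries are linear in $\gamma$. If the vanishing ideal had a minimal prime of
height below 2, factoriality of $S(\mathfrak g_e)$ would make that prime $(f)$, with $f$ dividing
such a determinant and hence homogeneous of positive degree. Over an algebraically closed field $f$
would have a zero at $\beta$ or at some $\alpha+s\beta$, where all points are regular
(`two_le_dualCodim_of_plane`).

Regularity follows from two bounds. Every stabiliser has dimension at least $\dim V$, by deforming
$e$ to $e+tx$ and comparing with centralisers in $\mathfrak{gl}(V)$
(`finrank_le_finrank_coadjointStabiliser`). For the plane, take $\alpha$ diagonal with distinct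
nonzero entries and $\beta$ subdiagonal with respect to Jordan blocks of decreasing size. The
stabiliser equations become a recursion on coefficient strings, which leaves at most one free string
per block, so at most $\sum_i \mathrm{len}_i=\dim V$ parameters (`eq_zero_of_diagonal`,
`eq_zero_of_row`). -/

open Polynomial in
/-- In a polynomial ring over a domain, a factor of a nonzero monomial is a monomial. -/
theorem exists_eq_C_mul_X_pow_of_mul_eq {R : Type*} [CommRing R] [IsDomain R] {p q : R[X]}
    {a : R} {r : ℕ} (ha : a ≠ 0) (h : p * q = C a * X ^ r) : ∃ c k, p = C c * X ^ k := by
  have hpq : p * q ≠ 0 := by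
    rw [h]
    exact mul_ne_zero (C_ne_zero.2 ha) (pow_ne_zero _ X_ne_zero)
  have hp := left_ne_zero_of_mul hpq
  have hq := right_ne_zero_of_mul hpq
  -- Degree and trailing degree are both additive and agree on the product, so they agree on `p`.
  have h1 := natDegree_mul hp hq
  have h2 := natTrailingDegree_mul hp hq
  rw [h, natDegree_C_mul_X_pow _ _ ha] at h1
  rw [h, C_mul_X_pow_eq_monomial, natTrailingDegree_monomial ha] at h2
  have h3 := natTrailingDegree_le_natDegree p
  have h4 := natTrailingDegree_le_natDegree q
  refine ⟨p.coeff p.natDegree, p.natDegree, ?_⟩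
  ext n
  rw [coeff_C_mul_X_pow]
  split_ifs with hn
  · rw [hn]
  · rcases lt_or_gt_of_ne hn with hn | hn
    · exact coeff_eq_zero_of_lt_natTrailingDegree (by omega)
    · exact coeff_eq_zero_of_natDegree_lt hn

/-- A nonzero prime ideal of height less than two in a factorial ring is generated by a prime
element. -/
theorem exists_prime_eq_span_of_height_lt_two {R : Type*} [CommRing R] [IsDomain R]
    [UniqueFactorizationMonoid R] {P : Ideal R} [P.IsPrime] (h0 : P ≠ ⊥) (h : P.height < 2) :
    ∃ f : R, Prime f ∧ P = Ideal.span {f} := by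
  have h1 : P.height = 1 := by
    have h2 : P.height ≠ 0 := by rwa [Ne, Ideal.height_eq_zero_iff_eq_bot]
    refine le_antisymm ?_ (Order.one_le_iff_ne_zero.2 h2)
    exact ENat.lt_add_one_iff (by simp) |>.1 (by rwa [one_add_one_eq_two])
  obtain ⟨f, hfP, hf⟩ := Ideal.IsPrime.exists_mem_prime_of_ne_bot ‹_› h0
  exact ⟨f, hf, Ideal.eq_span_singleton_of_height_eq_one h1 hfP hf⟩

/-! ### Homogeneity in the symmetric algebra and the codimension criterion -/

section SymmetricAlgebra

variable {K M : Type*} [Field K] [AddCommGroup M] [Module K M]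

instance SymmetricAlgebra.instUniqueFactorizationMonoid :
    UniqueFactorizationMonoid (SymmetricAlgebra K M) :=
  (SymmetricAlgebra.equivMvPolynomial (Module.Basis.ofVectorSpace K M)).symm.toMulEquiv
    |>.uniqueFactorizationMonoid inferInstance

theorem mem_dualVanishingIdeal {Z : Set (Module.Dual K M)} {f : SymmetricAlgebra K M} :
    f ∈ dualVanishingIdeal Z ↔ ∀ γ ∈ Z, SymmetricAlgebra.lift γ f = 0 := by
  simp [dualVanishingIdeal, Submodule.mem_iInf, RingHom.mem_ker]

theorem lift_det_map_ι {r : ℕ} (A : Matrix (Fin r) (Fin r) M) {B : Type*} [CommRing B] [Algebra K B]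
    (γ : M →ₗ[K] B) :
    SymmetricAlgebra.lift γ (A.map (SymmetricAlgebra.ι K M)).det = (A.map γ).det := by
  rw [AlgHom.map_det]
  congr 1
  ext i j
  simp

open Polynomial in
variable (K M) in
/-- The coaction `m ↦ X * m` of the multiplicative group on the symmetric algebra. -/
noncomputable def symmetricAlgebraScaling :
    SymmetricAlgebra K M →ₐ[K] (SymmetricAlgebra K M)[X] :=
  SymmetricAlgebra.lift ((LinearMap.mulLeft K (X : (SymmetricAlgebra K M)[X])) ∘ₗ
    (CAlgHom (R := K)).toLinearMap ∘ₗ SymmetricAlgebra.ι K M)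

-- The general target `B` serves two uses: `B = K` gives values at `t • γ`, and `B = S(M)` allows
-- setting `X` to 0 or 1.
open Polynomial in
theorem lift_mulLeft_eq_eval₂ {B : Type*} [CommRing B] [Algebra K B] (γ : M →ₗ[K] B) (t : B)
    (f : SymmetricAlgebra K M) :
    SymmetricAlgebra.lift (LinearMap.mulLeft K t ∘ₗ γ) f =
      (symmetricAlgebraScaling K M f).eval₂ (SymmetricAlgebra.lift γ).toRingHom t := by
  have h1 : SymmetricAlgebra.lift (LinearMap.mulLeft K t ∘ₗ γ)
      = (eval₂AlgHom (SymmetricAlgebra.lift γ) t (fun _ => Commute.all _ _)).comp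
        (symmetricAlgebraScaling K M) := by
    apply SymmetricAlgebra.algHom_ext
    ext m
    simp [symmetricAlgebraScaling, eval₂AlgHom, eval₂RingHom']
    exact mul_comm _ _
  rw [h1]
  rfl

open Polynomial in
/-- A prime factor of the determinant of a matrix of linear forms is homogeneous of positive
degree. -/
theorem exists_lift_smul_eq_of_dvd_det {f : SymmetricAlgebra K M} (hf : Prime f) {r : ℕ}
    {A : Matrix (Fin r) (Fin r) M} (hA : (A.map (SymmetricAlgebra.ι K M)).det ≠ 0)
    (hdvd : f ∣ (A.map (SymmetricAlgebra.ι K M)).det) :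
    ∃ k ≠ 0, ∀ (t : K) (γ : Module.Dual K M),
      SymmetricAlgebra.lift (t • γ) f = t ^ k * SymmetricAlgebra.lift γ f := by
  set ι := SymmetricAlgebra.ι K M with hι
  let S := SymmetricAlgebra K M
  set φ := symmetricAlgebraScaling K M with hφ_def
  obtain ⟨g, hg⟩ := hdvd
  have hφ : φ f * φ g = C (A.map ι).det * X ^ r := by
    rw [← map_mul, ← hg, hφ_def, symmetricAlgebraScaling, lift_det_map_ι]
    have h1 : (A.map ι).map C = C.mapMatrix (A.map ι) := rfl
    have h2 := Matrix.det_smul ((A.map ι).map C) (X : S[X])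
    rw [h1, ← RingHom.map_det, Fintype.card_fin, mul_comm] at h2
    rw [← h2]
    rfl
  obtain ⟨c, k, hc⟩ := exists_eq_C_mul_X_pow_of_mul_eq hA hφ
  -- Setting `X = 1` undoes the scaling.
  have hcf : c = f := by
    have := lift_mulLeft_eq_eval₂ ι 1 f
    rw [← hφ_def, hc] at this
    simpa [hι] using this.symm
  subst hcf
  refine ⟨k, ?_, fun t γ => ?_⟩
  -- If `k = 0`, setting `X = 0` shows that the prime equals its constant term, hence is zero or a
  -- unit.
  · rintro rfl
    have := lift_mulLeft_eq_eval₂ ι 0 c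
    rw [← hφ_def, hc] at this
    have h2 : SymmetricAlgebra.lift (LinearMap.mulLeft K (0 : S) ∘ₗ ι)
        = (Algebra.ofId K S).comp SymmetricAlgebra.algebraMapInv := by
      apply SymmetricAlgebra.algHom_ext
      ext m
      simp [hι, Algebra.ofId_apply, SymmetricAlgebra.algebraMapInv_ι]
    rw [h2] at this
    simp only [hι, SymmetricAlgebra.lift_ι, AlgHom.comp_apply, pow_zero, mul_one, eval₂_C] at this
    by_cases hz : SymmetricAlgebra.algebraMapInv c = 0
    · rw [hz, map_zero] at this
      exact hf.ne_zero this.symm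
    · apply hf.not_isUnit
      have hu : IsUnit (Algebra.ofId K S (SymmetricAlgebra.algebraMapInv c)) :=
        (isUnit_iff_ne_zero.2 hz).map _
      rw [this] at hu
      exact hu
  · have := lift_mulLeft_eq_eval₂ γ t c
    rw [← hφ_def, hc] at this
    simp only [eval₂_mul, eval₂_C, eval₂_pow, eval₂_X] at this
    rw [mul_comm]
    exact this

open Polynomial in
theorem exists_polynomial_eval_eq_lift_add_smul (f : SymmetricAlgebra K M)
    (α β : Module.Dual K M) :
    ∃ p : K[X], ∀ s, p.eval s = SymmetricAlgebra.lift (α + s • β) f := by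
  let θ : M →ₗ[K] K[X] := (CAlgHom (R := K)).toLinearMap ∘ₗ α +
    (LinearMap.mulLeft K (X : K[X])) ∘ₗ (CAlgHom (R := K)).toLinearMap ∘ₗ β
  refine ⟨SymmetricAlgebra.lift θ f, fun s => ?_⟩
  have : (aeval s).comp (SymmetricAlgebra.lift θ) = SymmetricAlgebra.lift (α + s • β) := by
    apply SymmetricAlgebra.algHom_ext
    ext m
    simp [θ]
    exact mul_comm _ _
  rw [← this, AlgHom.comp_apply, coe_aeval_eq_eval]

open Polynomial in
/-- A subset of `M^*` has codimension at least two as soon as there is a plane in `M^*` every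
nonzero point of which is separated from the subset by a determinant of linear forms. -/
theorem two_le_dualCodim_of_plane [IsAlgClosed K] {Z : Set (Module.Dual K M)}
    (α β : Module.Dual K M)
    (hZ : ∀ γ, γ = β ∨ (∃ s : K, γ = α + s • β) → ∃ (r : ℕ) (A : Matrix (Fin r) (Fin r) M),
      (∀ γ' ∈ Z, (A.map γ').det = 0) ∧ (A.map γ).det ≠ 0) :
    2 ≤ dualCodim Z := by
  rw [dualCodim, Ideal.height_eq_inf_minimalPrimes]
  refine le_iInf₂ fun P hP => ?_
  have hPp : P.IsPrime := hP.1.1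
  have hIP : dualVanishingIdeal Z ≤ P := hP.1.2
  by_contra! hlt
  have hsep : ∀ γ, γ = β ∨ (∃ s : K, γ = α + s • β) → ∃ (r : ℕ) (A : Matrix (Fin r) (Fin r) M),
      (A.map (SymmetricAlgebra.ι K M)).det ∈ P ∧
      SymmetricAlgebra.lift γ (A.map (SymmetricAlgebra.ι K M)).det ≠ 0 := by
    intro γ hγ
    obtain ⟨r, A, h1, h2⟩ := hZ γ hγ
    refine ⟨r, A, hIP (mem_dualVanishingIdeal.2 fun γ' hγ' => ?_), ?_⟩
    · rw [lift_det_map_ι, h1 γ' hγ']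
    · rwa [lift_det_map_ι]
  obtain ⟨r, A, hAP, hA⟩ := hsep β (Or.inl rfl)
  have hA0 : (A.map (SymmetricAlgebra.ι K M)).det ≠ 0 := by
    intro h
    rw [h, map_zero] at hA
    exact hA rfl
  have hP0 : P ≠ ⊥ := by
    rintro rfl
    exact hA0 (by simpa using hAP)
  obtain ⟨f, hf, rfl⟩ := exists_prime_eq_span_of_height_lt_two hP0 hlt
  obtain ⟨k, hk, hhom⟩ :=
    exists_lift_smul_eq_of_dvd_det hf hA0 (Ideal.mem_span_singleton.1 hAP)
  have hne : ∀ γ, γ = β ∨ (∃ s : K, γ = α + s • β) → SymmetricAlgebra.lift γ f ≠ 0 := by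
    intro γ hγ h0
    obtain ⟨r, A, hAP, hA⟩ := hsep γ hγ
    obtain ⟨g, hg⟩ := Ideal.mem_span_singleton.1 hAP
    rw [hg, map_mul, h0, zero_mul] at hA
    exact hA rfl
  obtain ⟨p, hp⟩ := exists_polynomial_eval_eq_lift_add_smul f α β
  obtain ⟨q, hq⟩ := exists_polynomial_eval_eq_lift_add_smul f β α
  have hpdeg : p.degree = 0 := by
    -- A root of `p` would be a zero of `f` on the line `α + s • β`; so `f` is constant there.
    by_contra hd
    obtain ⟨s, hs⟩ := IsAlgClosed.exists_root p hd
    exact hne _ (Or.inr ⟨s, rfl⟩) ((hp s).symm.trans hs)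
  rw [eq_C_of_degree_eq_zero hpdeg] at hp
  set c := p.coeff 0
  -- By homogeneity `f (β + t α) = t ^ k * f (α + t⁻¹ β) = c * t ^ k` for `t ≠ 0`; the polynomial
  -- identity extends this to `t = 0`, forcing `f β = 0`.
  have hqc : q = C c * X ^ k := by
    apply eq_of_infinite_eval_eq
    refine Set.Infinite.mono (s := {0}ᶜ) ?_ (Set.finite_singleton (0 : K)).infinite_compl
    intro t ht
    have ht : t ≠ 0 := ht
    have h1 : β + t • α = t • (α + t⁻¹ • β) := by
      rw [smul_add, smul_smul, mul_inv_cancel₀ ht, one_smul, add_comm]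
    change q.eval t = _
    rw [hq, h1, hhom, ← hp, eval_C, eval_mul, eval_C, eval_pow, eval_X, mul_comm]
  apply hne β (Or.inl rfl)
  have := hq 0
  rw [zero_smul, add_zero] at this
  rw [← this, hqc, eval_mul, eval_pow, eval_X, zero_pow hk, mul_zero]

end SymmetricAlgebra

/-! ### Separating regular functions from the singular locus -/

/-- A linear function outside the singular locus is separated from it by a determinant of linear
forms, namely the Gram determinant of a complement of its stabiliser. -/
theorem exists_det_ne_zero_of_notMem_singularLocus {K Q : Type*} [Field K] [LieRing Q]
    [LieAlgebra K Q] [FiniteDimensional K Q] {γ : Module.Dual K Q} (hγ : γ ∉ singularLocus K Q) :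
    ∃ (r : ℕ) (A : Matrix (Fin r) (Fin r) Q),
      (∀ γ' ∈ singularLocus K Q, (A.map γ').det = 0) ∧ (A.map γ).det ≠ 0 := by
  obtain ⟨U, hU⟩ := (coadjointStabiliser K γ).exists_isCompl
  let u := Module.finBasis K U
  let A : Matrix (Fin (Module.finrank K U)) (Fin (Module.finrank K U)) Q :=
    Matrix.of fun i j => ⁅(u j : Q), (u i : Q)⁆
  have hA : ∀ (δ : Module.Dual K Q) (v : Fin (Module.finrank K U) → K),
      (A.map δ).mulVec v = fun i => δ ⁅((u.equivFun.symm v : U) : Q), (u i : Q)⁆ := by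
    intro δ v
    ext i
    rw [Module.Basis.equivFun_symm_apply]
    push_cast
    rw [sum_lie]
    simp [A, Matrix.mulVec, dotProduct, mul_comm]
  refine ⟨_, A, fun γ' hγ' => ?_, fun h0 => ?_⟩
  · have hγ : Module.finrank K (coadjointStabiliser K γ) ≤ lieIndex K Q := not_lt.1 hγ
    have hγ' : lieIndex K Q < Module.finrank K (coadjointStabiliser K γ') := hγ'
    have hdim := Submodule.finrank_add_eq_of_isCompl hU
    -- The stabiliser of `γ'` is too large to avoid a complement of the stabiliser of `γ`.
    have hnd : ¬ Disjoint (coadjointStabiliser K γ') U := by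
      intro hd
      have := Submodule.finrank_add_finrank_le_of_disjoint hd
      omega
    rw [Submodule.disjoint_def] at hnd
    push Not at hnd
    obtain ⟨x, hx, hxU, hx0⟩ := hnd
    rw [← Matrix.exists_mulVec_eq_zero_iff]
    refine ⟨u.equivFun ⟨x, hxU⟩, ?_, ?_⟩
    · rw [Ne, LinearEquiv.map_eq_zero_iff]
      simpa using hx0
    · rw [hA, LinearEquiv.symm_apply_apply]
      ext i
      exact hx _
  · rw [← Matrix.exists_mulVec_eq_zero_iff] at h0
    obtain ⟨v, hv, h0⟩ := h0
    rw [hA] at h0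
    set x := u.equivFun.symm v with hx
    have hxU : ∀ y : U, γ ⁅(x : Q), (y : Q)⁆ = 0 := by
      let ℓ : U →ₗ[K] K := γ ∘ₗ (LieAlgebra.ad K Q (x : Q) : Q →ₗ[K] Q) ∘ₗ U.subtype
      have : ℓ = 0 := u.ext fun i => congrFun h0 i
      exact fun y => LinearMap.congr_fun this y
    have hxs : (x : Q) ∈ coadjointStabiliser K γ := by
      intro y
      obtain ⟨w, hw, z, hz, rfl⟩ := Submodule.mem_sup.1
        (hU.sup_eq_top ▸ Submodule.mem_top : y ∈ coadjointStabiliser K γ ⊔ U)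
      rw [lie_add, map_add, hxU ⟨z, hz⟩, add_zero, ← lie_skew, map_neg, hw, neg_zero]
    have := (Submodule.disjoint_def.1 hU.disjoint) _ hxs x.2
    have hx0 : x = 0 := by simpa using this
    exact hv (u.equivFun.symm.map_eq_zero_iff.1 hx0)

/-! ### Lower bound for the index -/

/-- Injectivity is an open condition on linear pencils. -/
theorem exists_ne_zero_injective_add_smul {K E F : Type*} [Field K] [Infinite K] [AddCommGroup E]
    [Module K E] [FiniteDimensional K E] [AddCommGroup F] [Module K F] (f g : E →ₗ[K] F)
    (hf : Function.Injective f) : ∃ t : K, t ≠ 0 ∧ Function.Injective (f + t • g) := by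
  obtain ⟨h, hh⟩ := f.exists_leftInverse_of_injective (LinearMap.ker_eq_bot.2 hf)
  let N : Module.End K E := h ∘ₗ g
  -- After applying the left inverse `h`, the pencil is `1 + t N`, which is injective for `t = -μ⁻¹`
  -- with `μ` not an eigenvalue.
  obtain ⟨μ, hμ⟩ := ((N.finite_hasEigenvalue).union (Set.finite_singleton 0)).infinite_compl.nonempty
  simp only [Set.mem_compl_iff, Set.mem_union, Set.mem_ofPred_eq, Set.mem_singleton_iff, not_or] at hμ
  refine ⟨-μ⁻¹, by simpa using hμ.2, ?_⟩
  rw [injective_iff_map_eq_zero]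
  intro v hv
  by_contra hv0
  apply hμ.1
  apply Module.End.hasEigenvalue_of_hasEigenvector (x := v)
  refine ⟨Module.End.mem_eigenspace_iff.2 ?_, hv0⟩
  have h1 : h (f v) = v := LinearMap.congr_fun hh v
  have h2 := congrArg h hv
  simp only [LinearMap.add_apply, LinearMap.smul_apply, map_add, map_smul, h1, map_zero] at h2
  have h3 : v = μ⁻¹ • N v := by
    rw [neg_smul, ← sub_eq_add_neg, sub_eq_zero] at h2
    exact h2
  nth_rewrite 2 [h3]
  rw [smul_smul, mul_inv_cancel₀ hμ.2, one_smul]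

open Polynomial DirectSum in
/-- The centraliser of an endomorphism of a vector space has at least the dimension of the
space. -/
theorem finrank_le_finrank_ker_ad {K V : Type*} [Field K] [AddCommGroup V] [Module K V]
    [FiniteDimensional K V] (A : Module.End K V) :
    Module.finrank K V ≤
      Module.finrank K (LinearMap.ker (LieAlgebra.ad K (Module.End K V) A)) := by
  obtain ⟨ι, _, p, -, k, ⟨Φ⟩⟩ := Module.equiv_directSum_of_isTorsion
    (Module.AEval.isTorsion_of_finiteDimensional K V A)
  classical
  -- `B` is a commutative ring on which `A` acts as `X`; its multiplications commute with `A` and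
  -- are determined by their value at 1.
  let B := ∀ i, K[X] ⧸ Ideal.span {p i ^ k i}
  let Ψ : Module.AEval' A ≃ₗ[K[X]] B := Φ.trans (DirectSum.linearEquivFunOnFintype K[X] ι _)
  let φ : V ≃ₗ[K] B := (Module.AEval'.of A).trans (Ψ.restrictScalars K)
  have hφ : ∀ v, φ (A v) = (X : K[X]) • φ v := by
    intro v
    change Ψ (Module.AEval'.of A (A v)) = (X : K[X]) • Ψ (Module.AEval'.of A v)
    rw [← Module.AEval'.X_smul_of, map_smul]
  let L : V →ₗ[K] Module.End K V :=
    (LinearMap.mul K B).compl₁₂ φ.toLinearMap φ.toLinearMap |>.compr₂ φ.symm.toLinearMap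
  have hL : ∀ v u, L v u = φ.symm (φ v * φ u) := fun v u => rfl
  have hmem : ∀ v, L v ∈ LinearMap.ker (LieAlgebra.ad K (Module.End K V) A) := by
    intro v
    rw [LinearMap.mem_ker]
    change A * L v - L v * A = 0
    rw [sub_eq_zero]
    ext u
    apply φ.injective
    rw [Module.End.mul_apply, Module.End.mul_apply, hφ, hL, hL, hφ, LinearEquiv.apply_symm_apply,
      LinearEquiv.apply_symm_apply, mul_smul_comm]
  refine LinearMap.finrank_le_finrank_of_injective (f := L.codRestrict _ hmem) ?_
  intro v w hvw
  have := LinearMap.congr_fun (Subtype.ext_iff.1 hvw) (φ.symm 1)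
  simpa [hL] using this

/-- Every linear function on `End V` is of the form `y ↦ tr (x y)`. -/
theorem exists_trace_mul_eq {K V : Type*} [Field K] [AddCommGroup V] [Module K V]
    [FiniteDimensional K V] (ℓ : Module.Dual K (Module.End K V)) :
    ∃ x : Module.End K V, ∀ y, ℓ y = LinearMap.trace K V (x * y) := by
  let T : Module.End K V →ₗ[K] Module.Dual K (Module.End K V) :=
    (LinearMap.mul K (Module.End K V)).compr₂ (LinearMap.trace K V)
  have hinj : Function.Injective T := by
    rw [injective_iff_map_eq_zero]
    intro x hx
    ext v
    rw [LinearMap.zero_apply, ← Module.forall_dual_apply_eq_zero_iff K]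
    intro φ
    have h1 : x * φ.smulRight v = φ.smulRight (x v) := by
      ext w
      simp
    have h2 : LinearMap.trace K V (x * φ.smulRight v) = 0 := LinearMap.congr_fun hx (φ.smulRight v)
    rwa [h1, LinearMap.trace_smulRight] at h2
  obtain ⟨x, hx⟩ := (LinearMap.injective_iff_surjective_of_finrank_eq_finrank
    (Subspace.dual_finrank_eq).symm).1 hinj ℓ
  exact ⟨x, fun y => by rw [← hx]; rfl⟩

/-- The index of a centraliser in `gl(V)` is at least `dim V`. -/
theorem finrank_le_finrank_coadjointStabiliser {K V : Type*} [Field K] [Infinite K]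
    [AddCommGroup V] [Module K V] [FiniteDimensional K V] (e : Module.End K V)
    (γ : Module.Dual K (elementCentraliser K e)) :
    Module.finrank K V ≤ Module.finrank K (coadjointStabiliser K γ) := by
  let q := elementCentraliser K e
  have he : ∀ y : q, ⁅e, (y : Module.End K V)⁆ = 0 := fun y => by
    rw [← lie_skew, neg_eq_zero]
    exact y.2
  obtain ⟨ℓ, hℓ⟩ := LinearMap.exists_extend (p := q.toSubmodule) γ
  obtain ⟨x, hx⟩ := exists_trace_mul_eq ℓ
  have hγ : ∀ y : q, γ y = LinearMap.trace K V (x * y) := fun y => by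
    rw [← hx, ← hℓ]
    rfl
  obtain ⟨W, hW⟩ := q.toSubmodule.exists_isCompl
  obtain ⟨U, hU⟩ := (coadjointStabiliser K γ).exists_isCompl
  let ad : Module.End K V → (Module.End K V →ₗ[K] Module.End K V) :=
    fun a => LieAlgebra.ad K (Module.End K V) a
  have had : ∀ a b, ad a b = ⁅a, b⁆ := fun a b => rfl
  let incl : U →ₗ[K] Module.End K V := q.toSubmodule.subtype ∘ₗ U.subtype
  -- This is the leading part of `ad (e + t • x)` at `w + t⁻¹ • u`: since `[e, u] = 0`, the value
  -- there is `f (w, u) + t • g (w, u)`.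
  let f : W × U →ₗ[K] Module.End K V := (ad e ∘ₗ W.subtype).coprod (ad x ∘ₗ incl)
  let g : W × U →ₗ[K] Module.End K V := ad x ∘ₗ W.subtype ∘ₗ LinearMap.fst K W U
  have hf : Function.Injective f := by
    rw [injective_iff_map_eq_zero]
    rintro ⟨w, u⟩ hwu
    have hwu : ⁅e, (w : Module.End K V)⁆ + ⁅x, incl u⁆ = 0 := hwu
    -- Pairing with `z` in the centraliser under the trace form kills `[e, w]` and leaves `γ [u, z]
    -- = 0`.
    have hu : u = 0 := by
      have : (u : q) ∈ coadjointStabiliser K γ := by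
        intro z
        have h1 := congrArg (fun y => LinearMap.trace K V (y * z)) hwu
        simp only [add_mul, map_add, zero_mul, map_zero] at h1
        rw [← lie_skew, neg_mul, map_neg, LinearMap.trace_lie_mul_eq, LinearMap.trace_lie_mul_eq,
          he, mul_zero, map_zero, neg_zero, zero_add] at h1
        rw [hγ]
        exact h1
      have := Submodule.disjoint_def.1 hU.disjoint _ this u.2
      simpa using this
    subst hu
    rw [map_zero, lie_zero, add_zero] at hwu
    have hw : (w : Module.End K V) ∈ q.toSubmodule := by
      change ⁅(w : Module.End K V), e⁆ = 0
      rw [← lie_skew, hwu, neg_zero]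
    have := Submodule.disjoint_def.1 hW.disjoint _ hw w.2
    simpa using this
  obtain ⟨t, ht, hinj⟩ := exists_ne_zero_injective_add_smul f g hf
  have hrange : LinearMap.range (f + t • g) ≤ LinearMap.range (ad (e + t • x)) := by
    rintro _ ⟨⟨w, u⟩, rfl⟩
    refine ⟨w + t⁻¹ • incl u, ?_⟩
    have h2 : (f + t • g) (w, u) = ⁅e, (w : Module.End K V)⁆ + ⁅x, incl u⁆ +
      t • ⁅x, (w : Module.End K V)⁆ := rfl
    have h1 : ⁅e, incl u⁆ = 0 := he u
    rw [h2, had, add_lie, lie_add, lie_add, lie_smul, h1, smul_zero, smul_lie, smul_lie, lie_smul,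
      smul_smul, mul_inv_cancel₀ ht, one_smul]
    abel
  -- Thus `dim W + dim U` is at most the rank of `ad (e + t • x)`, which is at most `dim End V - dim
  -- V`.
  have h1 := Submodule.finrank_mono hrange
  rw [LinearMap.finrank_range_of_inj hinj, Module.finrank_prod] at h1
  have h2 := (ad (e + t • x)).finrank_range_add_finrank_ker
  have h3 : Module.finrank K V ≤ Module.finrank K (LinearMap.ker (ad (e + t • x))) :=
    finrank_le_finrank_ker_ad (e + t • x)
  have h4 := Submodule.finrank_add_eq_of_isCompl hW
  have h5 := Submodule.finrank_add_eq_of_isCompl hU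
  have h6 : Module.finrank K (elementCentraliser K e) = Module.finrank K q.toSubmodule := rfl
  omega

/-! ### Jordan decomposition -/

/-- A decomposition of `V` into cyclic `e`-modules of antitone lengths `len i`, with generators
`w i` and with linear functions `ε i` which read off the coefficient of `e ^ (len i - 1) (w i)`.
The families are indexed by the natural numbers and vanish from the index `d` on. -/
structure JordanChains {K V : Type*} [Field K] [AddCommGroup V] [Module K V]
    (e : Module.End K V) where
  d : ℕ
  len : ℕ → ℕ
  w : ℕ → V
  ε : ℕ → Module.Dual K V
  len_antitone : Antitone len
  len_eq_zero : ∀ i, d ≤ i → len i = 0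
  sum_len : ∑ i ∈ Finset.range d, len i = Module.finrank K V
  pow_len_w : ∀ i, (e ^ len i) (w i) = 0
  ε_pow_len : ∀ i v, ε i ((e ^ len i) v) = 0
  ε_pow_w : ∀ q p u, ε q ((e ^ u) (w p)) = if q = p ∧ u + 1 = len q then 1 else 0
  eq_zero_of_ε : ∀ v, (∀ q u, ε q ((e ^ u) v) = 0) → v = 0
  eq_zero_of_w : ∀ y : Module.End K V, Commute y e → (∀ p, y (w p) = 0) → y = 0

section Cyclic

open Polynomial

variable {K : Type*} [Field K]

/-- The coefficient of `X ^ (k - 1)` on `K[X] / (X ^ k)`, which is zero if `k = 0`. -/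
noncomputable def topCoeff (k : ℕ) : (K[X] ⧸ Ideal.span {(X : K[X]) ^ k}) →ₗ[K] K :=
  (((Ideal.span {(X : K[X]) ^ k}).restrictScalars K).liftQ
    -- Multiplying by `X` and reading degree `k` avoids a truncated `k - 1` when `k = 0`.
    (lcoeff K k ∘ₗ LinearMap.mulLeft K (X : K[X])) (by
      intro f hf
      obtain ⟨g, rfl⟩ := Ideal.mem_span_singleton.1 hf
      rw [LinearMap.mem_ker]
      change (X * (X ^ k * g)).coeff k = 0
      rw [← mul_assoc, ← pow_succ', coeff_X_pow_mul', if_neg (by omega)])) ∘ₗ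
  (Submodule.Quotient.restrictScalarsEquiv K (Ideal.span {(X : K[X]) ^ k})).symm.toLinearMap

theorem topCoeff_X_pow_smul_mk (k u : ℕ) (f : K[X]) :
    topCoeff k ((X ^ u : K[X]) • (Ideal.Quotient.mk (Ideal.span {(X : K[X]) ^ k}) f)) =
      if u + 1 ≤ k then f.coeff (k - (u + 1)) else 0 := by
  change (X * (X ^ u * f)).coeff k = _
  rw [← mul_assoc, ← pow_succ', coeff_X_pow_mul']

theorem X_pow_smul_quotient_eq_zero (k : ℕ) (n : K[X] ⧸ Ideal.span {(X : K[X]) ^ k}) :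
    (X ^ k : K[X]) • n = 0 := by
  obtain ⟨f, rfl⟩ := Ideal.Quotient.mk_surjective n
  change Ideal.Quotient.mk (Ideal.span {(X : K[X]) ^ k}) (X ^ k * f) = 0
  rw [Ideal.Quotient.eq_zero_iff_mem]
  exact Ideal.mul_mem_right _ _ (Ideal.mem_span_singleton_self _)

theorem eq_zero_of_topCoeff {k : ℕ} {n : K[X] ⧸ Ideal.span {(X : K[X]) ^ k}}
    (h : ∀ u, topCoeff k ((X ^ u : K[X]) • n) = 0) : n = 0 := by
  obtain ⟨f, rfl⟩ := Ideal.Quotient.mk_surjective n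
  rw [Ideal.Quotient.eq_zero_iff_mem, Ideal.mem_span_singleton, X_pow_dvd_iff]
  intro i hi
  have := h (k - 1 - i)
  rw [topCoeff_X_pow_smul_mk, if_pos (by omega)] at this
  rwa [show k - (k - 1 - i + 1) = i by omega] at this

theorem topCoeff_X_pow_smul_one (k u : ℕ) :
    topCoeff k ((X ^ u : K[X]) • (1 : K[X] ⧸ Ideal.span {(X : K[X]) ^ k})) =
      if u + 1 = k then 1 else 0 := by
  have := topCoeff_X_pow_smul_mk k u (1 : K[X])
  rw [map_one] at this
  rw [this, coeff_one]
  split_ifs <;> first | rfl | omega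

open DirectSum in
/-- Every nilpotent endomorphism of a finite-dimensional vector space has a Jordan decomposition. -/
theorem exists_jordanChains {V : Type*} [AddCommGroup V] [Module K V]
    [FiniteDimensional K V] {e : Module.End K V} (he : IsNilpotent e) :
    Nonempty (JordanChains e) := by
  classical
  obtain ⟨n, hn⟩ := he
  have htors : Module.IsTorsion' (Module.AEval' e) (Submonoid.powers (X : K[X])) := by
    intro x
    refine ⟨⟨X ^ n, n, rfl⟩, ?_⟩
    obtain ⟨v, rfl⟩ := (Module.AEval'.of e).surjective x
    change (X ^ n : K[X]) • Module.AEval'.of e v = 0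
    rw [Module.AEval.X_pow_smul_of, hn, zero_smul, map_zero]
  obtain ⟨d, k, ⟨Φ⟩⟩ := Module.torsion_by_prime_power_decomposition irreducible_X htors
  let B := ∀ i : Fin d, K[X] ⧸ Ideal.span {(X : K[X]) ^ k i}
  let Ψ : Module.AEval' e ≃ₗ[K[X]] B := Φ.trans (DirectSum.linearEquivFunOnFintype K[X] (Fin d) _)
  let φ : V ≃ₗ[K] B := (Module.AEval'.of e).trans (Ψ.restrictScalars K)
  have hφ : ∀ u v, φ ((e ^ u) v) = (X ^ u : K[X]) • φ v := by
    intro u v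
    change Ψ (Module.AEval'.of e ((e ^ u) v)) = (X ^ u : K[X]) • Ψ (Module.AEval'.of e v)
    rw [← map_smul, Module.AEval.X_pow_smul_of]
    rfl
  let σ : Equiv.Perm (Fin d) := Tuple.sort (fun i => OrderDual.toDual (k i))
  have hσ : ∀ i j, i ≤ j → k (σ j) ≤ k (σ i) := fun i j hij =>
    Tuple.monotone_sort (fun i => OrderDual.toDual (k i)) hij
  let len : ℕ → ℕ := fun i => if h : i < d then k (σ ⟨i, h⟩) else 0
  let w : ℕ → V := fun i => if h : i < d then φ.symm (Pi.single (σ ⟨i, h⟩) 1) else 0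
  let ε : ℕ → Module.Dual K V := fun i =>
    if h : i < d then topCoeff (k (σ ⟨i, h⟩)) ∘ₗ LinearMap.proj (σ ⟨i, h⟩) ∘ₗ φ.toLinearMap else 0
  have hlen : ∀ i (h : i < d), len i = k (σ ⟨i, h⟩) := fun i h => dif_pos h
  have hw : ∀ i (h : i < d), φ (w i) = Pi.single (σ ⟨i, h⟩) 1 := fun i h => by
    simp only [w, dif_pos h, LinearEquiv.apply_symm_apply]
  have hε : ∀ i (h : i < d) v, ε i v = topCoeff (k (σ ⟨i, h⟩)) (φ v (σ ⟨i, h⟩)) := fun i h v => by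
    simp only [ε, dif_pos h]
    rfl
  have hlen0 : ∀ i, ¬ i < d → len i = 0 := fun i h => dif_neg h
  have hw0 : ∀ i, ¬ i < d → w i = 0 := fun i h => dif_neg h
  have hε0 : ∀ i, ¬ i < d → ε i = 0 := fun i h => dif_neg h
  refine ⟨⟨d, len, w, ε, ?_, fun i hi => hlen0 i (not_lt.2 hi), ?_, ?_, ?_, ?_, ?_, ?_⟩⟩
  · intro i j hij
    by_cases hj : j < d
    · have hi : i < d := lt_of_le_of_lt hij hj
      rw [hlen i hi, hlen j hj]
      exact hσ _ _ hij
    · rw [hlen0 j hj]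
      exact Nat.zero_le _
  · rw [← Fin.sum_univ_eq_sum_range]
    have h1 : ∀ i : Fin d, len i = k (σ i) := fun i => hlen i i.2
    have hfin : ∀ i : Fin d, Module.finrank K (K[X] ⧸ Ideal.span {(X : K[X]) ^ k i}) = k i :=
      fun i => by rw [finrank_quotient_span_eq_natDegree, natDegree_X_pow]
    have hmod : ∀ i : Fin d, Module.Finite K (K[X] ⧸ Ideal.span {(X : K[X]) ^ k i}) :=
      fun i => (monic_X_pow (k i)).finite_quotient
    rw [Finset.sum_congr rfl fun i _ => h1 i, Equiv.sum_comp σ k, φ.finrank_eq,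
      Module.finrank_pi_fintype]
    exact Finset.sum_congr rfl fun i _ => (hfin i).symm
  · intro i
    by_cases hi : i < d
    · apply φ.injective
      rw [hφ, hw i hi, hlen i hi, map_zero]
      ext1 j
      by_cases hj : j = σ ⟨i, hi⟩
      · subst hj
        exact X_pow_smul_quotient_eq_zero _ _
      · rw [Pi.smul_apply, Pi.single_eq_of_ne hj, smul_zero, Pi.zero_apply]
    · rw [hw0 i hi, map_zero]
  · intro i v
    by_cases hi : i < d
    · rw [hε i hi, hφ, hlen i hi, Pi.smul_apply, X_pow_smul_quotient_eq_zero, map_zero]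
    · rw [hε0 i hi, LinearMap.zero_apply]
  · intro q p u
    by_cases hq : q < d
    · by_cases hp : p < d
      · rw [hε q hq, hφ, hw p hp, Pi.smul_apply, hlen q hq]
        by_cases hqp : q = p
        · subst hqp
          rw [Pi.single_eq_same, topCoeff_X_pow_smul_one]
          simp
        · rw [Pi.single_eq_of_ne, smul_zero, map_zero, if_neg (fun h => hqp h.1)]
          intro h
          exact hqp (by simpa using h)
      · rw [hw0 p hp, map_zero, map_zero, if_neg]
        rintro ⟨rfl, -⟩
        exact hp hq
    · rw [hε0 q hq, LinearMap.zero_apply, if_neg]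
      rintro ⟨-, h⟩
      rw [hlen0 q hq] at h
      omega
  · intro v hv
    apply φ.injective
    rw [map_zero]
    ext1 j
    rw [Pi.zero_apply]
    apply eq_zero_of_topCoeff
    intro u
    obtain ⟨i, rfl⟩ := σ.surjective j
    have := hv i u
    rw [hε i i.2, hφ] at this
    exact this
  · intro y hy h
    have hpow : ∀ u v, y ((e ^ u) v) = (e ^ u) (y v) := fun u v =>
      LinearMap.congr_fun (hy.pow_right u).eq v
    -- Commuting with `e` means being `K[X]`-linear, so `y` is determined by its values on the
    -- generators.
    let y' : B →ₗ[K[X]] B := Ψ.toLinearMap ∘ₗ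
      (LinearMap.ofAEval e ((Module.AEval'.of e).toLinearMap ∘ₗ y) (fun m => by
        change Module.AEval'.of e (y (e m)) = (X : K[X]) • Module.AEval'.of e (y m)
        rw [Module.AEval'.X_smul_of]
        exact congrArg _ (LinearMap.congr_fun hy.eq m))) ∘ₗ Ψ.symm.toLinearMap
    have hy' : ∀ v, y' (φ v) = φ (y v) := by
      intro v
      change Ψ (Module.AEval'.of e (y ((Module.AEval'.of e).symm (Ψ.symm (Ψ (Module.AEval'.of e v))))))
        = Ψ (Module.AEval'.of e (y v))
      rw [LinearEquiv.symm_apply_apply, LinearEquiv.symm_apply_apply]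
    have hy0 : y' = 0 := by
      refine LinearMap.pi_ext fun j n => ?_
      obtain ⟨f, rfl⟩ := Ideal.Quotient.mk_surjective n
      obtain ⟨i, rfl⟩ := σ.surjective j
      have h1 : (Pi.single (σ i) (Ideal.Quotient.mk _ f) : B) = f • φ (w i) := by
        rw [hw i i.2, ← Pi.single_smul]
        congr 1
        change _ = Ideal.Quotient.mk _ (f * 1)
        rw [mul_one]
      rw [h1, map_smul, hy', h, map_zero, smul_zero, LinearMap.zero_apply]
    ext v
    apply φ.injective
    rw [← hy', hy0, LinearMap.zero_apply, LinearMap.zero_apply, map_zero]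

end Cyclic

/-! ### Solving the stabiliser equations -/

section Recursion

variable {K : Type*} [Field K] {len : ℕ → ℕ} {Y : ℕ → ℕ → ℕ → K}

/-- A finitely supported sequence with `a f(u + l - m) = b f(u)`, where `a ≠ b` are nonzero,
vanishes. -/
theorem eq_zero_of_shift_relation {f : ℕ → K} {a b : K} (ha : a ≠ 0) (hb : b ≠ 0) (hab : a ≠ b)
    {l m : ℕ} (hf : ∀ u, l ≤ u → f u = 0)
    (h : ∀ N, l ≤ N → m ≤ N → a * f (N - l) = b * f (N - m)) (u : ℕ) : f u = 0 := by
  -- Descending induction on `u`: the larger of `l` and `m` is used to pick `N`, so that the other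
  -- side has an index already treated.
  have key : ∀ k u, l ≤ u + k → f u = 0 := by
    intro k
    induction k with
    | zero => exact fun u hu => hf u hu
    | succ k ih =>
      intro u hu
      rcases lt_trichotomy l m with hlm | rfl | hlm
      · have := h (u + m) (by omega) (by omega)
        rw [ih (u + m - l) (by omega), mul_zero, Nat.add_sub_cancel] at this
        exact (mul_eq_zero.1 this.symm).resolve_left hb
      · have := h (u + l) (by omega) (by omega)
        rw [Nat.add_sub_cancel, ← sub_eq_zero, ← sub_mul] at this
        exact (mul_eq_zero.1 this).resolve_left (sub_ne_zero.2 hab)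
      · have := h (u + l) (by omega) (by omega)
        rw [ih (u + l - m) (by omega), mul_zero, Nat.add_sub_cancel] at this
        exact (mul_eq_zero.1 this).resolve_left ha
  exact key l u (by omega)

/-- The equations which express that `Y` lies in the stabiliser of the linear function attached
to the diagonal `a` and the multiple `c` of the subdiagonal. -/
def StabiliserRelation (len : ℕ → ℕ) (a : ℕ → K) (c : K) (Y : ℕ → ℕ → ℕ → K) : Prop :=
  ∀ q p N, len q ≤ N → len p ≤ N →
    a q * Y q p (N - len q) + c * Y (q + 1) p (N - len q) =
      a p * Y q p (N - len p) + c * (if p = 0 then 0 else Y q (p - 1) (N - len p))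

/-- The terms with coefficient `c` have column minus row smaller by one than `(q, p)`. Induction on
that difference removes them and leaves a shift relation with distinct factors `a q`, `a p`. On the
diagonal the factors coincide, so vanishing there has to be assumed. -/
theorem StabiliserRelation.eq_zero_of_diagonal {a : ℕ → K} {c : K} {d : ℕ}
    (h : StabiliserRelation len a c Y) (ha : ∀ i, a i ≠ 0) (ha' : Function.Injective a)
    (hd : ∀ q p u, d ≤ q → Y q p u = 0)
    (hlen : ∀ q p u, len q ≤ u → Y q p u = 0) (hdiag : ∀ q u, Y q q u = 0) (q p u : ℕ) :
    Y q p u = 0 := by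
  have step : ∀ q p, q ≠ p → (∀ u, Y (q + 1) p u = 0) → (∀ u, p ≠ 0 → Y q (p - 1) u = 0) →
      ∀ u, Y q p u = 0 := by
    intro q p hqp h1 h2
    refine eq_zero_of_shift_relation (ha q) (ha p) (fun h => hqp (ha' h)) (hlen q p)
      (m := len p) fun N hq hp => ?_
    have := h q p N hq hp
    rw [h1, mul_zero, add_zero] at this
    rw [this]
    split_ifs with hp0
    · rw [mul_zero, add_zero]
    · rw [h2 _ hp0, mul_zero, add_zero]
  have lower : ∀ k q p, p < q → d ≤ q - p + k → ∀ u, Y q p u = 0 := by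
    intro k
    induction k with
    | zero => exact fun q p hqp hk u => hd q p u (by omega)
    | succ k ih =>
      intro q p hqp hk
      exact step q p (by omega) (ih _ _ (by omega) (by omega))
        fun u hp => ih _ _ (by omega) (by omega) u
  have upper : ∀ k q p, p = q + k → ∀ u, Y q p u = 0 := by
    intro k
    induction k with
    | zero =>
      intro q p hk
      rw [hk]
      exact hdiag q
    | succ k ih =>
      intro q p hk
      exact step q p (by omega) (ih _ _ (by omega)) fun u hp => ih _ _ (by omega) u
  rcases lt_or_ge p q with hpq | hpq
  · exact lower d q p hpq (by omega) u
  · exact upper (p - q) q p (by omega) u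

/-- The relations identify neighbouring strings on each diagonal up to a shift. Strings strictly
below the main diagonal vanish from the bottom end `d` upwards, the others from row 0 downwards;
monotonicity of `len` ensures that the shift reaches every index `u` in the required direction. -/
theorem StabiliserRelation.eq_zero_of_row {d : ℕ} (hanti : Antitone len)
    (h : StabiliserRelation len 0 1 Y) (hd : ∀ q p u, d ≤ q → Y q p u = 0)
    (hrow : ∀ p u, Y 0 p u = 0) (q p u : ℕ) : Y q p u = 0 := by
  have h' : ∀ q p N, len q ≤ N → len (p + 1) ≤ N →
      Y (q + 1) (p + 1) (N - len q) = Y q p (N - len (p + 1)) := by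
    intro q p N hq hp
    simpa using h q (p + 1) N hq hp
  have lower : ∀ k q p, p < q → d ≤ q + k → ∀ u, Y q p u = 0 := by
    intro k
    induction k with
    | zero => exact fun q p _ hk u => hd q p u hk
    | succ k ih =>
      intro q p hqp hk u
      have hl : len q ≤ len (p + 1) := hanti hqp
      have := h' q p (u + len (p + 1)) (by omega) (by omega)
      rwa [ih (q + 1) (p + 1) (by omega) (by omega), Nat.add_sub_cancel, eq_comm] at this
  have upper : ∀ q p, q ≤ p → ∀ u, Y q p u = 0 := by
    intro q
    induction q with
    | zero => exact fun p _ u => hrow p u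
    | succ q ih =>
      intro p hqp u
      obtain ⟨p, rfl⟩ : ∃ p', p = p' + 1 := ⟨p - 1, by omega⟩
      have hl : len (p + 1) ≤ len q := hanti (by omega)
      have := h' q p (u + len q) (by omega) (by omega)
      rwa [ih p (by omega), Nat.add_sub_cancel] at this
  rcases lt_or_ge p q with hpq | hpq
  · exact lower d q p hpq (by omega) u
  · exact upper q p hpq u

end Recursion

/-! ### Coefficients on the centraliser and the bidiagonal functions -/

namespace JordanChains

variable {K V : Type*} [Field K] [AddCommGroup V] [Module K V] {e : Module.End K V}
  (D : JordanChains e)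

theorem w_eq_zero {i : ℕ} (hi : D.d ≤ i) : D.w i = 0 := by
  simpa [D.len_eq_zero i hi] using D.pow_len_w i

theorem ε_eq_zero {i : ℕ} (hi : D.d ≤ i) (v : V) : D.ε i v = 0 := by
  simpa [D.len_eq_zero i hi] using D.ε_pow_len i v

/-- The coefficient of `e ^ (len q - 1 - u) (w q)` in `y (w p)`. -/
def coeff (q p u : ℕ) : Module.End K V →ₗ[K] K :=
  D.ε q ∘ₗ (e ^ u) ∘ₗ LinearMap.applyₗ (D.w p)

theorem coeff_apply (q p u : ℕ) (y : Module.End K V) :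
    D.coeff q p u y = D.ε q ((e ^ u) (y (D.w p))) := rfl

theorem coeff_eq_zero_of_len_le_left {q u : ℕ} (h : D.len q ≤ u) (p : ℕ) (y : Module.End K V) :
    D.coeff q p u y = 0 := by
  rw [coeff_apply, ← Nat.add_sub_cancel' h, pow_add, Module.End.mul_apply, D.ε_pow_len]

theorem coeff_eq_zero_of_len_le_right {p u : ℕ} (h : D.len p ≤ u) (q : ℕ) {y : Module.End K V}
    (hy : Commute y e) : D.coeff q p u y = 0 := by
  have h1 : (e ^ u) (y (D.w p)) = y ((e ^ u) (D.w p)) :=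
    LinearMap.congr_fun (hy.pow_right u).eq.symm _
  rw [coeff_apply, h1, ← Nat.sub_add_cancel h, pow_add, Module.End.mul_apply, D.pow_len_w, map_zero,
    map_zero, map_zero]

theorem coeff_eq_zero_of_le_left {q : ℕ} (h : D.d ≤ q) (p u : ℕ) (y : Module.End K V) :
    D.coeff q p u y = 0 := D.ε_eq_zero h _

theorem coeff_eq_zero_of_le_right {p : ℕ} (h : D.d ≤ p) (q u : ℕ) (y : Module.End K V) :
    D.coeff q p u y = 0 := by
  rw [coeff_apply, D.w_eq_zero h, map_zero, map_zero, map_zero]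

theorem eq_zero_of_coeff {y : Module.End K V} (hy : Commute y e)
    (h : ∀ q p u, D.coeff q p u y = 0) : y = 0 :=
  D.eq_zero_of_w y hy fun p => D.eq_zero_of_ε _ fun q u => h q p u

/-- The endomorphism which maps `w q` to `e ^ (m + 1 - len q) (w p)` and the other generators
to zero. -/
noncomputable def elem (q p m : ℕ) : Module.End K V :=
  ∑ x ∈ Finset.HasAntidiagonal.antidiagonal m, (D.ε q ∘ₗ (e ^ x.1)).smulRight ((e ^ x.2) (D.w p))

theorem elem_apply (q p m : ℕ) (v : V) :
    D.elem q p m v = ∑ x ∈ Finset.HasAntidiagonal.antidiagonal m, D.ε q ((e ^ x.1) v) • (e ^ x.2) (D.w p) := by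
  simp [elem]

/-- Both products are the antidiagonal sum for `m + 1` with one end term removed, and the two bounds
make the end terms vanish. -/
theorem commute_elem {q p m : ℕ} (hq : D.len q ≤ m + 1) (hp : D.len p ≤ m + 1) :
    Commute (D.elem q p m) e := by
  change D.elem q p m * e = e * D.elem q p m
  ext v
  rw [Module.End.mul_apply, Module.End.mul_apply, elem_apply, elem_apply, map_sum]
  have h1 := Finset.Nat.sum_antidiagonal_succ (n := m)
    (f := fun x => D.ε q ((e ^ x.1) v) • (e ^ x.2) (D.w p))
  have h2 := Finset.Nat.sum_antidiagonal_succ' (n := m)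
    (f := fun x => D.ε q ((e ^ x.1) v) • (e ^ x.2) (D.w p))
  have h3 : (e ^ (m + 1)) (D.w p) = 0 := by
    rw [← Nat.sub_add_cancel hp, pow_add, Module.End.mul_apply, D.pow_len_w, map_zero]
  have h4 : D.ε q ((e ^ (m + 1)) v) = 0 := by
    rw [← Nat.add_sub_cancel' hq, pow_add, Module.End.mul_apply, D.ε_pow_len]
  rw [h1] at h2
  simp only [h3, h4, smul_zero, zero_smul, zero_add] at h2
  simp only [map_smul]
  have h5 : ∀ k v, (e ^ (k + 1)) v = e ((e ^ k) v) := fun k v => by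
    rw [pow_succ', Module.End.mul_apply]
  simp only [h5 _ (D.w p)] at h2
  simpa only [pow_succ, Module.End.mul_apply] using h2

/-- Since `ε q` sees only the top of a chain, only the summand with first exponent `len q - 1` can
survive. For `len q = 0` there is none, and the right side vanishes as well. -/
theorem coeff_mul_elem {q p m : ℕ} (hq : D.len q ≤ m + 1) (hp : D.len p ≤ m + 1) (i j : ℕ)
    {y : Module.End K V} (hy : Commute y e) :
    D.coeff i j 0 (y * D.elem q p m) =
      if j = q then D.coeff i p (m + 1 - D.len q) y else 0 := by
  have hpow : ∀ u v, y ((e ^ u) v) = (e ^ u) (y v) := fun u v =>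
    LinearMap.congr_fun (hy.pow_right u).eq v
  have h1 : D.coeff i j 0 (y * D.elem q p m) = ∑ x ∈ Finset.HasAntidiagonal.antidiagonal m,
      (if q = j ∧ x.1 + 1 = D.len q then 1 else 0) * D.coeff i p x.2 y := by
    rw [coeff_apply, pow_zero, Module.End.one_apply, Module.End.mul_apply, elem_apply, map_sum,
      map_sum]
    refine Finset.sum_congr rfl fun x _ => ?_
    rw [map_smul, map_smul, D.ε_pow_w, hpow, smul_eq_mul, coeff_apply]
  rw [h1]
  split_ifs with hj
  · subst hj
    rcases Nat.eq_zero_or_pos (D.len j) with h0 | h0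
    · rw [D.coeff_eq_zero_of_len_le_right (by omega) _ hy]
      refine Finset.sum_eq_zero fun x _ => ?_
      rw [if_neg (by omega), zero_mul]
    · rw [Finset.sum_eq_single (D.len j - 1, m + 1 - D.len j)]
      · rw [if_pos ⟨rfl, by simp only; omega⟩, one_mul]
      · rintro ⟨s, t⟩ hst hne
        rw [Finset.HasAntidiagonal.mem_antidiagonal] at hst
        rw [if_neg, zero_mul]
        rintro ⟨-, h⟩
        simp only at h hst
        exact hne (by rw [Prod.mk.injEq]; omega)
      · intro h
        exact absurd (Finset.HasAntidiagonal.mem_antidiagonal.2 (by simp only; omega)) h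
  · refine Finset.sum_eq_zero fun x _ => ?_
    rw [if_neg (fun h => hj h.1.symm), zero_mul]

theorem coeff_elem_mul {q p m : ℕ} (hq : D.len q ≤ m + 1) (hp : D.len p ≤ m + 1) (i j : ℕ)
    (y : Module.End K V) :
    D.coeff i j 0 (D.elem q p m * y) =
      if i = p then D.coeff q j (m + 1 - D.len p) y else 0 := by
  have h1 : D.coeff i j 0 (D.elem q p m * y) = ∑ x ∈ Finset.HasAntidiagonal.antidiagonal m,
      D.coeff q j x.1 y * (if i = p ∧ x.2 + 1 = D.len i then 1 else 0) := by
    rw [coeff_apply, pow_zero, Module.End.one_apply, Module.End.mul_apply, elem_apply, map_sum]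
    refine Finset.sum_congr rfl fun x _ => ?_
    rw [map_smul, D.ε_pow_w, smul_eq_mul, coeff_apply]
  rw [h1]
  split_ifs with hi
  · subst hi
    rcases Nat.eq_zero_or_pos (D.len i) with h0 | h0
    · rw [D.coeff_eq_zero_of_len_le_left (by omega)]
      refine Finset.sum_eq_zero fun x _ => ?_
      rw [if_neg (by omega), mul_zero]
    · rw [Finset.sum_eq_single (m + 1 - D.len i, D.len i - 1)]
      · rw [if_pos ⟨rfl, by simp only; omega⟩, mul_one]
      · rintro ⟨s, t⟩ hst hne
        rw [Finset.HasAntidiagonal.mem_antidiagonal] at hst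
        rw [if_neg, mul_zero]
        rintro ⟨-, h⟩
        simp only at h hst
        exact hne (by rw [Prod.mk.injEq]; omega)
      · intro h
        exact absurd (Finset.HasAntidiagonal.mem_antidiagonal.2 (by simp only; omega)) h
  · refine Finset.sum_eq_zero fun x _ => ?_
    rw [if_neg (fun h => hi h.1), mul_zero]

/-- The linear function with the diagonal `a`. -/
noncomputable def diagFun (a : ℕ → K) : Module.Dual K (Module.End K V) :=
  ∑ i ∈ Finset.range D.d, a i • D.coeff i i 0

/-- The linear function with all subdiagonal entries one. -/
noncomputable def subdiagFun : Module.Dual K (Module.End K V) :=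
  ∑ i ∈ Finset.range D.d, D.coeff (i + 1) i 0

/-- The linear function on the centraliser with diagonal `a` and subdiagonal `c`. -/
noncomputable def bidiagFun (a : ℕ → K) (c : K) : Module.Dual K (elementCentraliser K e) :=
  (D.diagFun a + c • D.subdiagFun) ∘ₗ (elementCentraliser K e).toSubmodule.subtype

theorem commute_of_mem (y : elementCentraliser K e) : Commute (y : Module.End K V) e :=
  sub_eq_zero.1 y.2

/-- The relation at `N = m + 1` is the stabiliser condition tested on `elem q p m`; at `N = 0` both
chains are empty and every term is zero. -/
theorem stabiliserRelation {a : ℕ → K} {c : K} {y : elementCentraliser K e}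
    (hy : y ∈ coadjointStabiliser K (D.bidiagFun a c)) :
    StabiliserRelation D.len a c fun q p u => D.coeff q p u y := by
  intro q p N hq hp
  have hye := commute_of_mem y
  obtain _ | m := N
  · have h1 : ∀ i, D.coeff i p 0 (y : Module.End K V) = 0 := fun i =>
      D.coeff_eq_zero_of_len_le_right hp i hye
    have h2 : ∀ i, D.coeff q i 0 (y : Module.End K V) = 0 := fun i =>
      D.coeff_eq_zero_of_len_le_left hq i _
    simp [h1, h2]
  · let z : elementCentraliser K e := ⟨D.elem q p m, sub_eq_zero.2 (D.commute_elem hq hp)⟩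
    have h1 : (D.diagFun a + c • D.subdiagFun)
        ((y : Module.End K V) * D.elem q p m - D.elem q p m * y) = 0 := hy z
    have e1 : D.diagFun a ((y : Module.End K V) * D.elem q p m) =
        a q * D.coeff q p (m + 1 - D.len q) y := by
      simp only [diagFun, LinearMap.sum_apply, LinearMap.smul_apply, smul_eq_mul,
        D.coeff_mul_elem hq hp _ _ hye, mul_ite, mul_zero, Finset.sum_ite_eq', Finset.mem_range]
      rw [ite_eq_left_iff]
      intro h
      rw [D.coeff_eq_zero_of_le_left (not_lt.1 h), mul_zero]
    have e2 : D.subdiagFun ((y : Module.End K V) * D.elem q p m) =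
        D.coeff (q + 1) p (m + 1 - D.len q) y := by
      simp only [subdiagFun, LinearMap.sum_apply,
        D.coeff_mul_elem hq hp _ _ hye, Finset.sum_ite_eq', Finset.mem_range]
      rw [ite_eq_left_iff]
      intro h
      rw [D.coeff_eq_zero_of_le_left (by omega)]
    have e3 : D.diagFun a (D.elem q p m * (y : Module.End K V)) =
        a p * D.coeff q p (m + 1 - D.len p) y := by
      simp only [diagFun, LinearMap.sum_apply, LinearMap.smul_apply, smul_eq_mul,
        D.coeff_elem_mul hq hp, mul_ite, mul_zero, Finset.sum_ite_eq', Finset.mem_range]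
      rw [ite_eq_left_iff]
      intro h
      rw [D.coeff_eq_zero_of_le_right (not_lt.1 h), mul_zero]
    have e4 : D.subdiagFun (D.elem q p m * (y : Module.End K V)) =
        if p = 0 then 0 else D.coeff q (p - 1) (m + 1 - D.len p) y := by
      simp only [subdiagFun, LinearMap.sum_apply, D.coeff_elem_mul hq hp]
      obtain _ | p := p
      · simp
      · simp only [Nat.add_right_cancel_iff, Finset.sum_ite_eq', Finset.mem_range,
          Nat.add_sub_cancel, if_neg (Nat.succ_ne_zero p)]
        rw [ite_eq_left_iff]
        intro h
        rw [D.coeff_eq_zero_of_le_right (not_lt.1 h)]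
    rw [map_sub, LinearMap.add_apply, LinearMap.add_apply, LinearMap.smul_apply,
      LinearMap.smul_apply, e1, e2, e3, e4, smul_eq_mul, smul_eq_mul, sub_eq_zero] at h1
    exact h1

/-- A stabiliser whose elements are determined by one coefficient string for each Jordan block has
at most the dimension of `V`. -/
theorem finrank_coadjointStabiliser_le [FiniteDimensional K V]
    {γ : Module.Dual K (elementCentraliser K e)} (r : ℕ → ℕ)
    (h : ∀ y ∈ coadjointStabiliser K γ,
      (∀ i u, D.coeff (r i) i u (y : Module.End K V) = 0) → ∀ q p u, D.coeff q p u y = 0) :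
    Module.finrank K (coadjointStabiliser K γ) ≤ Module.finrank K V := by
  let T : coadjointStabiliser K γ →ₗ[K] ((Σ i : Fin D.d, Fin (D.len i)) → K) :=
    LinearMap.pi fun x => D.coeff (r x.1) x.1 x.2 ∘ₗ
      (elementCentraliser K e).toSubmodule.subtype ∘ₗ (coadjointStabiliser K γ).subtype
  have hT : Function.Injective T := by
    rw [injective_iff_map_eq_zero]
    rintro ⟨y, hy⟩ h0
    have hye := commute_of_mem y
    have : (y : Module.End K V) = 0 := by
      refine D.eq_zero_of_coeff hye (h y hy fun i u => ?_)
      by_cases hi : i < D.d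
      · by_cases hu : u < D.len i
        · exact congrFun h0 ⟨⟨i, hi⟩, ⟨u, hu⟩⟩
        · exact D.coeff_eq_zero_of_len_le_right (not_lt.1 hu) _ hye
      · exact D.coeff_eq_zero_of_le_right (not_lt.1 hi) _ _ _
    ext1
    exact Subtype.ext this
  have h1 := LinearMap.finrank_le_finrank_of_injective hT
  rw [Module.finrank_fintype_fun_eq_card, Fintype.card_sigma] at h1
  simp only [Fintype.card_fin] at h1
  rwa [Fin.sum_univ_eq_sum_range D.len, D.sum_len] at h1

/-- The free parameters are the diagonal strings; for `bidiagFun 0 1` below they are those of row 0.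
-/
theorem finrank_coadjointStabiliser_bidiagFun_le [FiniteDimensional K V] {a : ℕ → K}
    (ha : ∀ i, a i ≠ 0) (ha' : Function.Injective a) (c : K) :
    Module.finrank K (coadjointStabiliser K (D.bidiagFun a c)) ≤ Module.finrank K V :=
  D.finrank_coadjointStabiliser_le id fun _ hy h =>
    (D.stabiliserRelation hy).eq_zero_of_diagonal ha ha'
      (fun _ _ _ hq => D.coeff_eq_zero_of_le_left hq _ _ _)
      (fun _ _ _ hq => D.coeff_eq_zero_of_len_le_left hq _ _) h

theorem finrank_coadjointStabiliser_subdiag_le [FiniteDimensional K V] :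
    Module.finrank K (coadjointStabiliser K (D.bidiagFun 0 1)) ≤ Module.finrank K V :=
  D.finrank_coadjointStabiliser_le (fun _ => 0) fun _ hy h =>
    (D.stabiliserRelation hy).eq_zero_of_row D.len_antitone
      (fun _ _ _ hq => D.coeff_eq_zero_of_le_left hq _ _ _) h

theorem bidiagFun_add_smul (a : ℕ → K) (s : K) :
    D.bidiagFun a 0 + s • D.bidiagFun 0 1 = D.bidiagFun a s := by
  ext y
  simp [bidiagFun, diagFun]

end JordanChains

/-! ### Conclusion -/

theorem notMem_singularLocus_of_finrank_le {K V : Type*} [Field K] [Infinite K]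
    [AddCommGroup V] [Module K V] [FiniteDimensional K V] {e : Module.End K V}
    {γ : Module.Dual K (elementCentraliser K e)}
    (h : Module.finrank K (coadjointStabiliser K γ) ≤ Module.finrank K V) :
    γ ∉ singularLocus K (elementCentraliser K e) :=
  not_lt.2 (h.trans (le_ciInf fun δ => finrank_le_finrank_coadjointStabiliser e δ))

theorem theorem3p4 {K : Type*} [Field K] [IsAlgClosed K]
    {V : Type*} [AddCommGroup V] [Module K V] [FiniteDimensional K V]
    (hV : 2 ≤ Module.finrank K V)
    (e : Module.End K V) (he : IsNilpotent e) :
    2 ≤ dualCodim (singularLocus K (elementCentraliser K e)) := by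
  have : Infinite K := IsAlgClosed.instInfinite
  obtain ⟨D⟩ := exists_jordanChains he
  obtain ⟨a, ha, ha'⟩ : ∃ a : ℕ → K, (∀ i, a i ≠ 0) ∧ Function.Injective a := by
    have : Infinite {x : K // x ≠ 0} := (Set.finite_singleton (0 : K)).infinite_compl.to_subtype
    exact ⟨fun i => (Infinite.natEmbedding {x : K // x ≠ 0} i : K), fun i => (Infinite.natEmbedding {x : K // x ≠ 0} i).2,
      Subtype.val_injective.comp (Infinite.natEmbedding _).injective⟩
  -- For a single Jordan block the second function may be zero; the criterion does not need linear
  -- independence.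
  refine two_le_dualCodim_of_plane (D.bidiagFun a 0) (D.bidiagFun 0 1) fun γ hγ => ?_
  apply exists_det_ne_zero_of_notMem_singularLocus
  apply notMem_singularLocus_of_finrank_le
  rcases hγ with rfl | ⟨s, rfl⟩
  · exact D.finrank_coadjointStabiliser_subdiag_le
  · rw [D.bidiagFun_add_smul]
    exact D.finrank_coadjointStabiliser_bidiagFun_le ha ha' s
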